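/- **Conventions.** Let $n\in\mathbb N$, let $\|\cdot\|$ be the norm on $\mathbb C^{n\times n}$ subordinate to an arbitrary fixed vector norm on $\mathbb C^n$, and let $\kappa(A)=\|A\|\,\|A^{-1}\|$ for nonsingular $A$. Let $B_j\in\mathbb C^{n\times n}$ $(j\in\mathbb Z)$ with $B_j=0$ for all $j<\ell^-$, for some integer $\ell^->-\infty$; put $b_j=\|B_j\|$ and $F(\lambda)=\sum_{j\ge \ell^-}B_j\lambda^j$ on its open annulus of convergence $\Omega=\{R_1<|\lambda|<R_2\}$, where $R_1=\limsup_{j\to\infty} b_{-j}^{1/j}$ and $R_2^{-1}=\limsup_{j\to\infty} b_j^{1/j}$. Assume that $F$ is regular, i.e. $\det F\not\equiv 0$ on $\Omega$ (in particular $\Omega\neq\emptyset$). Let $\mathsf tF(x)=\sup_{b_j\ne0}(\log b_j+jx)$, let $D_+\subseteq\mathbb R$ be the interval on which it is finite, and call $\alpha>0$ a tropical root if $\log\alpha\in D_+$ and either $\mathsf tF$ is not differentiable at $\log\alpha$ or $\log\alpha$ is an endpoint of $D_+$. Let $(\alpha_j)_{j\in T}$ be the distinct tropical roots in increasing order, indexed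 by a set $T$ of consecutive integers. For $j$ with $j,j+1\in T$ let $k_j$ be the abscissa of the right endpoint of the segment of slope $-\log\alpha_j$ of the Newton polygon, the upper convex hull of $\{(i,\log b_i): b_i\neq0\}$, and let $\delta_j=\alpha_j/\alpha_{j+1}$. An eigenvalue of $F$ is a $\lambda$ with $F(\lambda)v=0$ for some $v\neq0$. Its multiplicity is its multiplicity as a zero of $\det F$. The number of eigenvalues minus poles of $F$ in a set is the number of zeros minus the number of poles of the meromorphic function $\det F$ there, counted with multiplicity (a zero or pole at $\lambda=0$ included). **Theorem 3.10.** 1. Let $j,j+1\in T$ and let $B_{k_j}$ be nonsingular. If $\delta_j\le(1+2\kappa(B_{k_j}))^{-2}$, then $F$ has exactly $n k_j$ eigenvalues minus poles in the closed disk $\{|\lambda|\le(1+2\kappa(B_{k_j}))\alpha_j\}$, and $F$ has no eigenvalues in the open annulus $(1+2\kappa(B_{k_j}))\alpha_j<|\lambda|<(1+2\kappa(B_{k_j}))^{-1}\alpha_{j+1}$. 2. Let $j<s$ with $j,j+1,s,s+1\in T$ and let $B_{k_j},B_{k_s}$ be nonsingular. If $\delta_j\le(1+2\kappa(B_{k_j}))^{-2}$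 and $\delta_s\le(1+2\kappa(B_{k_s}))^{-2}$, then $F$ has exactly $n(k_s-k_j)$ eigenvalues, counted with multiplicity, in the closed annulus $(1+2\kappa(B_{k_j}))^{-1}\alpha_{j+1}\le|\lambda|\le(1+2\kappa(B_{k_s}))\alpha_s$. -/

import Mathlib

noncomputable section

namespace TropLaurent

/-! ### Subordinate matrix norms and condition numbers -/

/-- The matrix norm subordinate to (induced by) a vector norm `p` on `ℂⁿ`: the least `c ≥ 0` such
that `p (A x) ≤ c * p x` for all `x`. -/
def subNorm {n : ℕ} (p : Seminorm ℂ (Fin n → ℂ)) (A : Matrix (Fin n) (Fin n) ℂ) : ℝ :=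
  sInf {c : ℝ | 0 ≤ c ∧ ∀ x : Fin n → ℂ, p (A.mulVec x) ≤ c * p x}

/-- The condition number `κ(A) = ‖A‖ ‖A⁻¹‖`; only meaningful for nonsingular `A`. -/
def cond {n : ℕ} (p : Seminorm ℂ (Fin n → ℂ)) (A : Matrix (Fin n) (Fin n) ℂ) : ℝ :=
  subNorm p A * subNorm p A⁻¹

/-! ### Tropical Laurent series, tropical roots, Newton polygon -/

/-- The (real) domain `D₊` of the max-plus tropical Laurent series with coefficients `log b_j`:
the real points where the supremum of `log b_j + j x` over the indices with `b_j ≠ 0` is finite. -/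
def tropDomain (b : ℤ → ℝ) : Set ℝ :=
  {x | BddAbove (Set.range fun j : {j : ℤ // b j ≠ 0} => Real.log (b j) + (j : ℤ) * x)}

/-- The max-plus tropical Laurent series `x ↦ sup_j (log b_j + j x)`, as a real function on
`tropDomain b`. -/
def tropSeries (b : ℤ → ℝ) (x : ℝ) : ℝ :=
  ⨆ j : {j : ℤ // b j ≠ 0}, (Real.log (b j) + (j : ℤ) * x)

/-- `a > 0` is a (nonzero) tropical root of the max-times series `sup_j b_j x ^ j`: the point
`log a` belongs to the interval `D₊`, and the max-plus series is not differentiable there or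
`log a` is an endpoint of `D₊`. -/
def IsTropicalRoot (b : ℤ → ℝ) (a : ℝ) : Prop :=
  0 < a ∧ Real.log a ∈ tropDomain b ∧
    (¬ DifferentiableAt ℝ (tropSeries b) (Real.log a) ∨ Real.log a ∉ interior (tropDomain b))

/-- `(α_j)_{j ∈ T}` lists all the distinct nonzero tropical roots in increasing order, the index
set `T` being a set of consecutive integers. -/
structure IsRootSequence (b : ℤ → ℝ) (T : Set ℤ) (α : ℤ → ℝ) : Prop where
  ordConnected : T.OrdConnected
  strictMono : StrictMonoOn α T
  image_eq : α '' T = {a | IsTropicalRoot b a}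

/-- The Newton polygon: the upper convex hull of the points `(j, log b_j)` with `b_j ≠ 0`, that is,
the convex hull of these points together with everything below them. -/
def newtonPolygon (b : ℤ → ℝ) : Set (ℝ × ℝ) :=
  convexHull ℝ {q : ℝ × ℝ | ∃ j : ℤ, b j ≠ 0 ∧ q.1 = j ∧ q.2 ≤ Real.log (b j)}

/-- The segment (face) of slope `σ` on the upper boundary of the Newton polygon: the points where
`y - σ x` is maximal on the polygon. -/
def newtonSegment (b : ℤ → ℝ) (σ : ℝ) : Set (ℝ × ℝ) :=
  {q | q ∈ newtonPolygon b ∧ ∀ q' ∈ newtonPolygon b, q'.2 - σ * q'.1 ≤ q.2 - σ * q.1}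

/-- The abscissa of the right endpoint of the segment of slope `σ` of the Newton polygon. -/
def rightVertex (b : ℤ → ℝ) (σ : ℝ) : ℤ :=
  sSup {k : ℤ | b k ≠ 0 ∧ ((k : ℝ), Real.log (b k)) ∈ newtonSegment b σ}

/-! ### Matrix Laurent series -/

/-- The sum `F(z) = ∑_j B_j z^j` of a matrix Laurent series. -/
def laurentSum {n : ℕ} (B : ℤ → Matrix (Fin n) (Fin n) ℂ) (z : ℂ) : Matrix (Fin n) (Fin n) ℂ :=
  ∑' j : ℤ, z ^ j • B j

open Filter in
/-- The inner radius of convergence `R₁ = limsup b_{-j}^{1/j}`, where `b_j = ‖B_j‖`. -/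
def innerRadius (b : ℤ → ℝ) : ENNReal :=
  limsup (fun j : ℕ => ENNReal.ofReal (b (-(j : ℤ))) ^ (1 / (j : ℝ))) atTop

open Filter in
/-- The outer radius of convergence `R₂`, with `R₂⁻¹ = limsup b_j^{1/j}`, where `b_j = ‖B_j‖`. -/
def outerRadius (b : ℤ → ℝ) : ENNReal :=
  (limsup (fun j : ℕ => ENNReal.ofReal (b (j : ℤ)) ^ (1 / (j : ℝ))) atTop)⁻¹

/-- The open annulus of convergence `Ω = {z | R₁ < |z| < R₂}`. -/
def convAnnulus (b : ℤ → ℝ) : Set ℂ :=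
  {z | innerRadius b < ‖z‖ₑ ∧ ‖z‖ₑ < outerRadius b}

/-! ### Eigenvalues -/

/-- `z` is an eigenvalue of the matrix function `F`: `F(z) v = 0` for some `v ≠ 0`. -/
def IsEigenvalue {n : ℕ} (F : ℂ → Matrix (Fin n) (Fin n) ℂ) (z : ℂ) : Prop :=
  ∃ v : Fin n → ℂ, v ≠ 0 ∧ (F z).mulVec v = 0

/-- `F` has exactly `N` eigenvalues minus poles in `S`: `det F` is meromorphic on `S` and nowhere
locally identically zero there, has finitely many zeros and poles in `S`, and the number of zeros
minus the number of poles, counted with multiplicities, is `N`. (The order at `z` only depends on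
`det F` in a punctured neighborhood of `z`, so the value assigned at a pole or at a removable
singularity plays no role.) -/
def HasEigenvaluesMinusPoles {n : ℕ} (F : ℂ → Matrix (Fin n) (Fin n) ℂ) (S : Set ℂ) (N : ℤ) :
    Prop :=
  MeromorphicOn (fun z => (F z).det) S ∧
  (∀ z ∈ S, meromorphicOrderAt (fun z => (F z).det) z ≠ ⊤) ∧
  {z ∈ S | meromorphicOrderAt (fun z => (F z).det) z ≠ 0}.Finite ∧
  ∑ᶠ z ∈ S, (meromorphicOrderAt (fun z => (F z).det) z).untop₀ = N

/-- `F` has exactly `N` eigenvalues in `S`, counted with algebraic multiplicities: `det F` is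
analytic at every point of `S` and nowhere locally identically zero there, `F` has finitely many
eigenvalues in `S`, and the sum of their multiplicities as zeros of `det F` is `N`. -/
def HasEigenvalues {n : ℕ} (F : ℂ → Matrix (Fin n) (Fin n) ℂ) (S : Set ℂ) (N : ℤ) : Prop :=
  AnalyticOnNhd ℂ (fun z => (F z).det) S ∧
  (∀ z ∈ S, analyticOrderAt (fun z => (F z).det) z ≠ ⊤) ∧
  {z ∈ S | IsEigenvalue F z}.Finite ∧
  ((∑ᶠ z ∈ {z ∈ S | IsEigenvalue F z}, analyticOrderNatAt (fun z => (F z).det) z : ℕ) : ℤ) = N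

end TropLaurent

end

open Filter Topology

namespace TropLaurent

/-! Between two consecutive tropical roots `a < c` the tropical series is affine, and its slope is
the vertex index `k`. Comparing at `a` and at `c`, the term of index `i` on the circle of radius `ρ`
is at most the `k`-th one times `(a/ρ)^(k-i)` for `i < k`, or `(ρ/c)^(i-k)` for `i > k`. Two
geometric series then show that `κ` times the relative size of all other terms is below 1 as soon as
`(1+2κ)a ≤ ρ ≤ (1+2κ)⁻¹c`. The condition on `δ_j` says that this range is nonempty.

On these circles the whole segment from `z^k B_k` to `F(z)` consists of nonsingular matrices
(`det_segment_ne_zero`), so `det F` has as many zeros minus poles inside as `z^(nk) det B_k`, namely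
`nk`. The homotopy invariance rests on Jensen's formula: over an annulus free of zeros and poles,
the circle average of `log ‖f‖` is affine in the logarithm of the radius, with slope the number of
zeros minus poles inside. This slope is continuous in the homotopy parameter and integer valued,
hence constant. The count in an annulus is the difference of two counts in disks. -/

/-! ### Tropical roots and dominant vertices -/

lemma eventually_forall_gt_le {b : ℤ → ℝ} {c d M : ℝ} {k : ℤ} (hcd : c < d)
    (hd : ∀ i, b i ≠ 0 → Real.log (b i) + i * d ≤ M)
    (hlt : ∀ i, k < i → b i ≠ 0 → Real.log (b i) + i * c < Real.log (b k) + k * c) :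
    ∀ᶠ x in 𝓝 c, ∀ i, k < i → b i ≠ 0 →
      Real.log (b i) + i * x ≤ Real.log (b k) + k * x := by
  -- For `i ≥ N` and `x < (c+d)/2`, the bound at `d` gives a value at most `M - N(d-c)/2`, already
  -- below that of `k`; only finitely many indices are left to continuity.
  obtain ⟨N, hN⟩ := exists_nat_gt ((M - (Real.log (b k) + k * c - 1)) / ((d - c) / 2))
  have hdc : 0 < (d - c) / 2 := by linarith
  rw [div_lt_iff₀ hdc] at hN
  have h1 : ∀ᶠ x in 𝓝 c, x < (c + d) / 2 := eventually_lt_nhds (by linarith)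
  have h2 : ∀ᶠ x in 𝓝 c, Real.log (b k) + k * c - 1 < Real.log (b k) + k * x := by
    have : ContinuousAt (fun x : ℝ => Real.log (b k) + k * x) c := by fun_prop
    exact this.eventually (eventually_gt_nhds (by linarith))
  have h3 : ∀ᶠ x in 𝓝 c, ∀ i ∈ Set.Ioc k (N : ℤ), b i ≠ 0 →
      Real.log (b i) + i * x ≤ Real.log (b k) + k * x := by
    rw [(Set.finite_Ioc k (N : ℤ)).eventually_all]
    intro i hi
    by_cases hbi : b i = 0
    · simp [hbi]
    have h := hlt i hi.1 hbi
    have hl : ContinuousAt (fun x : ℝ => Real.log (b i) + i * x) c := by fun_prop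
    have hr : ContinuousAt (fun x : ℝ => Real.log (b k) + k * x) c := by fun_prop
    filter_upwards [hl.eventually_lt hr h] with x hx _ using hx.le
  filter_upwards [h1, h2, h3] with x hx1 hx2 hx3 i hki hbi
  rcases le_or_gt i N with hiN | hiN
  · exact hx3 i ⟨hki, hiN⟩ hbi
  · have h4 := hd i hbi
    have h5 : (N : ℝ) ≤ i := by exact_mod_cast hiN.le
    have h6 : (N : ℝ) * ((d - c) / 2) ≤ i * (d - x) := by
      apply mul_le_mul h5 (by linarith) hdc.le
      exact (Nat.cast_nonneg N).trans h5
    nlinarith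

lemma mem_tropDomain_of_mem_Icc {b : ℤ → ℝ} {x₀ x₁ x : ℝ} (h0 : x₀ ∈ tropDomain b)
    (h1 : x₁ ∈ tropDomain b) (hx : x ∈ Set.Icc x₀ x₁) : x ∈ tropDomain b := by
  obtain ⟨M₀, hM₀⟩ := h0
  obtain ⟨M₁, hM₁⟩ := h1
  refine ⟨max M₀ M₁, ?_⟩
  rintro _ ⟨j, rfl⟩
  have e0 : Real.log (b j) + (j : ℤ) * x₀ ≤ M₀ := hM₀ ⟨j, rfl⟩
  have e1 : Real.log (b j) + (j : ℤ) * x₁ ≤ M₁ := hM₁ ⟨j, rfl⟩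
  rcases le_total 0 (j : ℤ) with hj | hj
  · have : (0 : ℝ) ≤ (j : ℤ) := by exact_mod_cast hj
    exact le_max_of_le_right (by nlinarith [hx.2])
  · have : ((j : ℤ) : ℝ) ≤ 0 := by exact_mod_cast hj
    exact le_max_of_le_left (by nlinarith [hx.1])

/-- The series lies above the affine function of index `k` and touches it at `x`, so their
difference has a local minimum there. -/
lemma deriv_tropSeries_of_isMax {b : ℤ → ℝ} {x : ℝ} {k : ℤ} (hk : b k ≠ 0)
    (hmax : ∀ i, b i ≠ 0 → Real.log (b i) + i * x ≤ Real.log (b k) + k * x)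
    (hD : tropDomain b ∈ 𝓝 x) (hd : DifferentiableAt ℝ (tropSeries b) x) :
    deriv (tropSeries b) x = k := by
  have hle : ∀ y ∈ tropDomain b, Real.log (b k) + k * y ≤ tropSeries b y := fun y hy =>
    le_ciSup (f := fun j : {j : ℤ // b j ≠ 0} => Real.log (b j) + (j : ℤ) * y) hy ⟨k, hk⟩
  have heq : tropSeries b x ≤ Real.log (b k) + k * x := by
    have : Nonempty {j : ℤ // b j ≠ 0} := ⟨⟨k, hk⟩⟩
    exact ciSup_le fun j => hmax j j.2
  have hmin : IsLocalMin (fun y => tropSeries b y - (Real.log (b k) + k * y)) x := by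
    filter_upwards [hD] with y hy
    have := hle y hy
    linarith
  have hlin : HasDerivAt (fun y : ℝ => Real.log (b k) + k * y) k x := by
    simpa using ((hasDerivAt_id x).const_mul (k : ℝ)).const_add (Real.log (b k))
  have := hmin.hasDerivAt_eq_zero (hd.hasDerivAt.sub hlin)
  linarith

/-- Let `X` be the last point up to `x₁` where `k` is maximal. If `X < x₁` and `k` beats all larger
indices at `X`, it still does so slightly to the right, while smaller indices only lose ground: a
contradiction. Otherwise some `m > k` ties at `X`, which is then interior, and the derivative there
would equal both `k` and `m`. -/
lemma le_of_differentiableOn_Ioo {b : ℤ → ℝ} {x₀ x₁ : ℝ} {k : ℤ} (h01 : x₀ < x₁)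
    (hD0 : x₀ ∈ tropDomain b) (hD1 : x₁ ∈ tropDomain b) (hk : b k ≠ 0)
    (hmax : ∀ i, b i ≠ 0 → Real.log (b i) + i * x₀ ≤ Real.log (b k) + k * x₀)
    (hlt : ∀ i, k < i → b i ≠ 0 → Real.log (b i) + i * x₀ < Real.log (b k) + k * x₀)
    (hdiff : ∀ x ∈ Set.Ioo x₀ x₁, DifferentiableAt ℝ (tropSeries b) x)
    {i : ℤ} (hi : b i ≠ 0) :
    Real.log (b i) + i * x₁ ≤ Real.log (b k) + k * x₁ := by
  by_contra hcon
  obtain ⟨M, hM⟩ := hD1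
  have hM' : ∀ i, b i ≠ 0 → Real.log (b i) + i * x₁ ≤ M := fun i hi => hM ⟨⟨i, hi⟩, rfl⟩
  set S : Set ℝ := {x | x ∈ Set.Icc x₀ x₁ ∧
    ∀ i, b i ≠ 0 → Real.log (b i) + i * x ≤ Real.log (b k) + k * x} with hS
  have hSc : IsClosed S := by
    have : S = Set.Icc x₀ x₁ ∩ ⋂ i : {i : ℤ // b i ≠ 0},
        {x : ℝ | Real.log (b i) + (i : ℤ) * x ≤ Real.log (b k) + k * x} := by
      ext x; simp [hS]
    rw [this]
    exact isClosed_Icc.inter (isClosed_iInter fun i =>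
      isClosed_le (by fun_prop) (by fun_prop))
  have hS0 : x₀ ∈ S := ⟨⟨le_rfl, h01.le⟩, hmax⟩
  have hSb : BddAbove S := ⟨x₁, fun x hx => hx.1.2⟩
  have hX : sSup S ∈ S := hSc.csSup_mem ⟨x₀, hS0⟩ hSb
  set X := sSup S with hXdef
  have hXlt : X < x₁ := lt_of_le_of_ne hX.1.2 fun h => hcon (h ▸ hX.2 i hi)
  by_cases hst : ∀ i, k < i → b i ≠ 0 → Real.log (b i) + i * X < Real.log (b k) + k * X
  · have hev := (eventually_forall_gt_le hXlt hM' hst).filter_mono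
      (nhdsWithin_le_nhds (s := Set.Ioi X))
    obtain ⟨y, hy, hyX⟩ := (hev.and (Ioo_mem_nhdsGT hXlt)).exists
    have : y ∈ S := by
      refine ⟨⟨hX.1.1.trans hyX.1.le, hyX.2.le⟩, fun i hi => ?_⟩
      rcases le_or_gt i k with hik | hik
      · have h1 := hmax i hi
        have h2 : (i : ℝ) ≤ k := by exact_mod_cast hik
        nlinarith [hX.1.1, hyX.1]
      · exact hy i hik hi
    exact absurd (le_csSup hSb this) (not_le.2 hyX.1)
  · push Not at hst
    obtain ⟨m, hkm, hbm, hm⟩ := hst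
    have hX0 : x₀ < X := lt_of_le_of_ne hX.1.1 fun h =>
      absurd (hlt m hkm hbm) (not_lt.2 (h ▸ hm))
    have hDX : tropDomain b ∈ 𝓝 X :=
      Filter.mem_of_superset (Ioo_mem_nhds hX0 hXlt) fun y hy =>
        mem_tropDomain_of_mem_Icc hD0 ⟨M, hM⟩ ⟨hy.1.le, hy.2.le⟩
    have hdX := hdiff X ⟨hX0, hXlt⟩
    have e1 := deriv_tropSeries_of_isMax hk hX.2 hDX hdX
    have e2 := deriv_tropSeries_of_isMax hbm (fun i hi => (hX.2 i hi).trans hm) hDX hdX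
    have : (k : ℝ) = m := e1.symm.trans e2
    exact absurd (by exact_mod_cast this) hkm.ne

/-- A linear functional has the same upper bounds on a set as on its convex hull, so the supporting
line can be tested on the points `(i, log b_i)` alone. -/
lemma mem_newtonSegment_iff {b : ℤ → ℝ} {x : ℝ} {k : ℤ} (hk : b k ≠ 0) :
    ((k : ℝ), Real.log (b k)) ∈ newtonSegment b (-x) ↔
      ∀ i, b i ≠ 0 → Real.log (b i) + i * x ≤ Real.log (b k) + k * x := by
  constructor
  · intro h i hi
    have := h.2 ((i : ℝ), Real.log (b i)) (subset_convexHull ℝ _ ⟨i, hi, rfl, le_rfl⟩)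
    simp only at this
    linarith
  · intro h
    refine ⟨subset_convexHull ℝ _ ⟨k, hk, rfl, le_rfl⟩, fun q hq => ?_⟩
    have hconv : Convex ℝ {q : ℝ × ℝ | q.2 - -x * q.1 ≤ Real.log (b k) - -x * k} := by
      intro u hu v hv s t hs ht hst
      simp only [Set.mem_ofPred_eq, Prod.snd_add, Prod.smul_snd, Prod.fst_add, Prod.smul_fst,
        smul_eq_mul] at hu hv ⊢
      have : s * (u.2 - -x * u.1) + t * (v.2 - -x * v.1) ≤
          s * (Real.log (b k) - -x * k) + t * (Real.log (b k) - -x * k) := by gcongr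
      rw [← add_mul, hst] at this
      linarith
    refine convexHull_min ?_ hconv hq
    rintro q ⟨i, hi, h1, h2⟩
    have := h i hi
    simp only [Set.mem_ofPred_eq, h1]
    linarith

/-- The supremum of integers defining `rightVertex` is meaningful only for a nonempty set bounded
above. Finiteness of the series at some `x₁ > x₀` bounds the competing indices above, and `ℓ` bounds
them below, so the maximum at `x₀` is attained at finitely many indices. -/
lemma rightVertex_spec {b : ℤ → ℝ} {ℓ : ℤ} (hℓ : ∀ i < ℓ, b i = 0) {x₀ x₁ : ℝ} (h01 : x₀ < x₁)
    (hD1 : x₁ ∈ tropDomain b) (hne : ∃ i, b i ≠ 0) {k : ℤ} (hk : k = rightVertex b (-x₀)) :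
    b k ≠ 0 ∧ (∀ i, b i ≠ 0 → Real.log (b i) + i * x₀ ≤ Real.log (b k) + k * x₀) ∧
      ∀ i, k < i → b i ≠ 0 → Real.log (b i) + i * x₀ < Real.log (b k) + k * x₀ := by
  obtain ⟨M, hM⟩ := hD1
  have hM' : ∀ i, b i ≠ 0 → Real.log (b i) + i * x₁ ≤ M := fun i hi => hM ⟨⟨i, hi⟩, rfl⟩
  obtain ⟨i₀, hi₀⟩ := hne
  set V : Set ℤ := {i | b i ≠ 0 ∧ Real.log (b i₀) + i₀ * x₀ ≤ Real.log (b i) + i * x₀} with hV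
  have hVfin : V.Finite := by
    obtain ⟨N, hN⟩ := exists_nat_gt ((M - (Real.log (b i₀) + i₀ * x₀)) / (x₁ - x₀))
    have hdc : 0 < x₁ - x₀ := by linarith
    rw [div_lt_iff₀ hdc] at hN
    refine (Set.finite_Icc ℓ (N : ℤ)).subset fun i hi => ⟨?_, ?_⟩
    · by_contra h
      exact hi.1 (hℓ i (not_le.1 h))
    · by_contra h
      have h5 : (N : ℝ) ≤ i := by exact_mod_cast (not_le.1 h).le
      nlinarith [hi.2, hM' i hi.1]
  obtain ⟨m, hmV, hm⟩ := hVfin.exists_maximalFor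
    (fun i : ℤ => Real.log (b i) + i * x₀) V ⟨i₀, hi₀, le_rfl⟩
  have hmax : ∀ i, b i ≠ 0 → Real.log (b i) + i * x₀ ≤ Real.log (b m) + m * x₀ := by
    intro i hi
    by_contra hcon
    exact hcon (hm ⟨hi, hmV.2.trans (not_le.1 hcon).le⟩ (not_le.1 hcon).le)
  set W : Set ℤ := {k : ℤ | b k ≠ 0 ∧ ((k : ℝ), Real.log (b k)) ∈ newtonSegment b (-x₀)} with hW
  have hWV : W ⊆ V := fun i hi => ⟨hi.1, (mem_newtonSegment_iff hi.1).1 hi.2 i₀ hi₀⟩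
  have hkW : k ∈ W := hk ▸ Int.csSup_mem ⟨m, hmV.1, (mem_newtonSegment_iff hmV.1).2 hmax⟩
    (hVfin.subset hWV).bddAbove
  have hkmax := (mem_newtonSegment_iff hkW.1).1 hkW.2
  refine ⟨hkW.1, hkmax, fun i hki hi => lt_of_le_of_ne (hkmax i hi) fun heq => ?_⟩
  have hiW : i ∈ W := ⟨hi, (mem_newtonSegment_iff hi).2 fun m hm => (hkmax m hm).trans heq.ge⟩
  have : i ≤ k := hk ▸ le_csSup (hVfin.subset hWV).bddAbove hiW
  omega

lemma exists_ne_zero_of_isTropicalRoot {b : ℤ → ℝ} {a : ℝ} (h : IsTropicalRoot b a) :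
    ∃ i, b i ≠ 0 := by
  by_contra hcon
  push Not at hcon
  have : IsEmpty {j : ℤ // b j ≠ 0} := ⟨fun j => j.2 (hcon j)⟩
  rcases h.2.2 with h | h
  · apply h
    -- A real supremum over an empty family is 0, so the series is constant.
    have : tropSeries b = fun _ => 0 := by
      ext x
      simp [tropSeries]
    rw [this]
    exact differentiableAt_const _
  · have : tropDomain b = Set.univ := by
      ext x
      simp [tropDomain, Set.range_eq_empty]
    simp [this] at h

/-- The vertex separating two consecutive tropical roots carries a dominant term at both roots. -/
lemma IsRootSequence.dominant {b : ℤ → ℝ} (hb0 : ∀ i, 0 ≤ b i) {ℓ : ℤ} (hℓ : ∀ i < ℓ, b i = 0)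
    {T : Set ℤ} {α : ℤ → ℝ} (hα : IsRootSequence b T α) {j : ℤ} (hj : j ∈ T) (hj1 : j + 1 ∈ T)
    {k : ℤ} (hk : k = rightVertex b (-Real.log (α j))) :
    0 < α j ∧ α j < α (j + 1) ∧ 0 < b k ∧ (∀ i, b i * α j ^ i ≤ b k * α j ^ k) ∧
      ∀ i, b i * α (j + 1) ^ i ≤ b k * α (j + 1) ^ k := by
  have hr : ∀ i ∈ T, IsTropicalRoot b (α i) := fun i hi => by
    have : α i ∈ α '' T := ⟨i, hi, rfl⟩
    rwa [hα.image_eq] at this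
  have hpos := (hr j hj).1
  have hlt : α j < α (j + 1) := hα.strictMono hj hj1 (by omega)
  have hpos1 := (hr _ hj1).1
  have hlog : Real.log (α j) < Real.log (α (j + 1)) := Real.log_lt_log hpos hlt
  obtain ⟨hbk, hmax, hst⟩ := rightVertex_spec hℓ hlog (hr _ hj1).2.1
    (exists_ne_zero_of_isTropicalRoot (hr j hj)) hk
  -- A corner in between would be a root `α i` with `j < i < j + 1`.
  have hdiff : ∀ x ∈ Set.Ioo (Real.log (α j)) (Real.log (α (j + 1))),
      DifferentiableAt ℝ (tropSeries b) x := by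
    intro x hx
    by_contra hnd
    have hroot : Real.exp x ∈ {a | IsTropicalRoot b a} := by
      refine ⟨Real.exp_pos x, ?_, ?_⟩
      · rw [Real.log_exp]
        exact mem_tropDomain_of_mem_Icc (hr j hj).2.1 (hr _ hj1).2.1 ⟨hx.1.le, hx.2.le⟩
      · rw [Real.log_exp]
        exact Or.inl hnd
    rw [← hα.image_eq] at hroot
    obtain ⟨i, hi, hix⟩ := hroot
    have h1 : α j < α i := by
      rw [hix]; exact (Real.log_lt_iff_lt_exp hpos).1 hx.1
    have h2 : α i < α (j + 1) := by
      rw [hix]; exact (Real.lt_log_iff_exp_lt hpos1).1 hx.2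
    have h3 := (hα.strictMono.lt_iff_lt hj hi).1 h1
    have h4 := (hα.strictMono.lt_iff_lt hi hj1).1 h2
    omega
  have hmax1 : ∀ i, b i ≠ 0 → Real.log (b i) + i * Real.log (α (j + 1)) ≤
      Real.log (b k) + k * Real.log (α (j + 1)) := fun i hi =>
    le_of_differentiableOn_Ioo hlog (hr j hj).2.1 (hr _ hj1).2.1 hbk hmax hst hdiff hi
  have hbk' : 0 < b k := lt_of_le_of_ne (hb0 k) (Ne.symm hbk)
  have key : ∀ a : ℝ, 0 < a → (∀ i, b i ≠ 0 → Real.log (b i) + i * Real.log a ≤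
      Real.log (b k) + k * Real.log a) → ∀ i, b i * a ^ i ≤ b k * a ^ k := by
    intro a ha h i
    by_cases hi : b i = 0
    · rw [hi, zero_mul]; positivity
    have hi' : 0 < b i := lt_of_le_of_ne (hb0 i) (Ne.symm hi)
    rw [← Real.log_le_log_iff (by positivity) (by positivity), Real.log_mul hi (by positivity),
      Real.log_mul hbk (by positivity), Real.log_zpow, Real.log_zpow]
    exact h i hi
  exact ⟨hpos, hlt, hbk', key _ hpos hmax, key _ hpos1 hmax1⟩

/-! ### Vector norms and subordinate matrix norms -/

section Norm

variable {n : ℕ} (p : Seminorm ℂ (Fin n → ℂ))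

lemma exists_seminorm_le_norm : ∃ C : ℝ, 0 ≤ C ∧ ∀ x, p x ≤ C * ‖x‖ := by
  refine ⟨∑ i, p (Pi.single i 1), Finset.sum_nonneg fun i _ => apply_nonneg p _, fun x => ?_⟩
  have hx : x = ∑ i, x i • (Pi.single i 1 : Fin n → ℂ) := pi_eq_sum_univ' x
  calc p x = p (∑ i, x i • (Pi.single i 1 : Fin n → ℂ)) := by rw [← hx]
    _ ≤ ∑ i, p (x i • (Pi.single i 1 : Fin n → ℂ)) :=
        Finset.le_sum_of_subadditive p (map_zero p).le (map_add_le_add p) _ _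
    _ ≤ ∑ i, p (Pi.single i 1) * ‖x‖ := by
        refine Finset.sum_le_sum fun i _ => ?_
        rw [map_smul_eq_mul, mul_comm]
        exact mul_le_mul_of_nonneg_left (norm_le_pi_norm x i) (apply_nonneg p _)
    _ = _ := by rw [Finset.sum_mul]

lemma continuous_seminorm : Continuous p := by
  obtain ⟨C, hC, h⟩ := exists_seminorm_le_norm p
  have hq : Continuous (C.toNNReal • normSeminorm ℂ (Fin n → ℂ)) := by
    change Continuous fun x : Fin n → ℂ => (C.toNNReal : ℝ) * ‖x‖
    fun_prop
  refine Seminorm.continuous_of_le hq fun x => (h x).trans ?_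
  change C * ‖x‖ ≤ (C.toNNReal : ℝ) * ‖x‖
  rw [Real.coe_toNNReal C hC]

variable {p} (hp : ∀ x, p x = 0 → x = 0)
include hp

lemma exists_norm_le_seminorm : ∃ m : ℝ, 0 < m ∧ ∀ x, m * ‖x‖ ≤ p x := by
  -- The unit sphere is empty exactly when `n = 0`; otherwise `p` attains a positive minimum on it.
  rcases (Metric.sphere (0 : Fin n → ℂ) 1).eq_empty_or_nonempty with he | hne
  · refine ⟨1, one_pos, fun x => ?_⟩
    have hx : x = 0 := by
      by_contra hx
      have : ((‖x‖⁻¹ : ℝ) : ℂ) • x ∈ Metric.sphere (0 : Fin n → ℂ) 1 := by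
        simp [norm_smul, norm_ne_zero_iff.2 hx]
      simp [he] at this
    simp [hx]
  · obtain ⟨x₀, hx₀, hmin⟩ := (isCompact_sphere (0 : Fin n → ℂ) 1).exists_isMinOn hne
      (continuous_seminorm p).continuousOn
    have hx₀' : x₀ ≠ 0 := by
      rintro rfl
      simp at hx₀
    refine ⟨p x₀, lt_of_le_of_ne (apply_nonneg p _) fun h => hx₀' (hp _ h.symm), fun x => ?_⟩
    by_cases hx : x = 0
    · simp [hx]
    have hxn : 0 < ‖x‖ := norm_pos_iff.2 hx
    have : ((‖x‖⁻¹ : ℝ) : ℂ) • x ∈ Metric.sphere (0 : Fin n → ℂ) 1 := by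
      simp [norm_smul, norm_ne_zero_iff.2 hx]
    have h1 : p x₀ ≤ p (((‖x‖⁻¹ : ℝ) : ℂ) • x) := hmin this
    rw [map_smul_eq_mul] at h1
    have h2 : ‖((‖x‖⁻¹ : ℝ) : ℂ)‖ = ‖x‖⁻¹ := by simp
    rw [h2, inv_mul_eq_div, le_div_iff₀ hxn] at h1
    exact h1

omit hp in
lemma subNorm_nonneg (A : Matrix (Fin n) (Fin n) ℂ) : 0 ≤ subNorm p A :=
  Real.sInf_nonneg fun _ hc => hc.1

/-- Equivalence of norms makes the set of admissible constants nonempty, so the infimum inherits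
their bound. -/
lemma seminorm_mulVec_le (A : Matrix (Fin n) (Fin n) ℂ) (x : Fin n → ℂ) :
    p (A.mulVec x) ≤ subNorm p A * p x := by
  obtain ⟨C, hC, hCx⟩ := exists_seminorm_le_norm p
  obtain ⟨m, hm, hmx⟩ := exists_norm_le_seminorm hp
  by_cases hx : x = 0
  · simp [hx]
  have hpx : 0 < p x := lt_of_le_of_ne (apply_nonneg p _) fun h => hx (hp _ h.symm)
  rw [← div_le_iff₀ hpx]
  refine le_csInf ?_ fun c hc => (div_le_iff₀ hpx).2 (hc.2 x)
  let K := ‖LinearMap.toContinuousLinearMap A.mulVecLin‖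
  have hK : ∀ y, ‖A.mulVec y‖ ≤ K * ‖y‖ := fun y =>
    (LinearMap.toContinuousLinearMap A.mulVecLin).le_opNorm y
  have hK0 : 0 ≤ K := norm_nonneg _
  refine ⟨C * K / m, by positivity, fun y => ?_⟩
  calc p (A.mulVec y) ≤ C * (K * ‖y‖) := (hCx _).trans (by gcongr; exact hK y)
    _ = C * K / m * (m * ‖y‖) := by field_simp
    _ ≤ C * K / m * p y := by gcongr; exact hmx y

lemma eq_zero_of_subNorm_eq_zero {A : Matrix (Fin n) (Fin n) ℂ} (h : subNorm p A = 0) :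
    A = 0 := by
  refine Matrix.ext_of_mulVec_single fun i => ?_
  rw [Matrix.zero_mulVec]
  refine hp _ (le_antisymm ?_ (apply_nonneg p _))
  simpa [h] using seminorm_mulVec_le hp A (Pi.single i 1)

omit hp in
lemma subNorm_zero : subNorm p (0 : Matrix (Fin n) (Fin n) ℂ) = 0 := by
  refine le_antisymm (csInf_le ⟨0, fun c hc => hc.1⟩ ⟨le_rfl, fun x => by simp⟩)
    (subNorm_nonneg _)

lemma exists_norm_entry_le : ∃ K : ℝ, 0 ≤ K ∧ ∀ (A : Matrix (Fin n) (Fin n) ℂ) (r c : Fin n),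
    ‖A r c‖ ≤ K * subNorm p A := by
  obtain ⟨m, hm, hmx⟩ := exists_norm_le_seminorm hp
  refine ⟨(∑ i, p (Pi.single i 1)) / m,
    div_nonneg (Finset.sum_nonneg fun i _ => apply_nonneg p _) hm.le, fun A r c => ?_⟩
  have h1 : A r c = (A.mulVec (Pi.single c 1)) r := by simp
  have h2 : p (Pi.single c 1) ≤ ∑ i, p (Pi.single i 1 : Fin n → ℂ) :=
    Finset.single_le_sum (f := fun i => p (Pi.single i 1 : Fin n → ℂ))
      (fun i _ => apply_nonneg p _) (Finset.mem_univ c)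
  rw [div_mul_eq_mul_div, le_div_iff₀ hm, mul_comm]
  calc m * ‖A r c‖ ≤ m * ‖A.mulVec (Pi.single c 1)‖ := by
        rw [h1]; gcongr; exact norm_le_pi_norm _ r
    _ ≤ p (A.mulVec (Pi.single c 1)) := hmx _
    _ ≤ subNorm p A * p (Pi.single c 1) := seminorm_mulVec_le hp A _
    _ ≤ subNorm p A * ∑ i, p (Pi.single i 1) := by
        gcongr; exact subNorm_nonneg A
    _ = _ := mul_comm _ _

/-- The assumption `0 < subNorm p A` also excludes `n = 0`, where every matrix has norm 0. -/
lemma cond_pos {A : Matrix (Fin n) (Fin n) ℂ} (hA : IsUnit A.det) (h : 0 < subNorm p A) :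
    0 < cond p A := by
  refine mul_pos h (lt_of_le_of_ne (subNorm_nonneg _) fun h0 => h.ne' ?_)
  have h1 : A⁻¹ = 0 := eq_zero_of_subNorm_eq_zero hp h0.symm
  have h2 : A = 0 := by
    rw [← Matrix.nonsing_inv_nonsing_inv A hA, h1, Matrix.inv_zero]
  rw [h2, subNorm_zero]

omit hp in
lemma seminorm_le_of_hasSum {ι : Type*} {f : ι → Fin n → ℂ} {w : Fin n → ℂ} {g : ι → ℝ} {s : ℝ}
    (hf : HasSum f w) (hg : HasSum g s) (h : ∀ i, p (f i) ≤ g i) : p w ≤ s := by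
  refine le_of_tendsto_of_tendsto' (((continuous_seminorm p).tendsto w).comp hf) hg fun t => ?_
  exact (Finset.le_sum_of_subadditive p (map_zero p).le (map_add_le_add p) _ _).trans
    (Finset.sum_le_sum fun i _ => h i)

end Norm

/-! ### Scalar Laurent series with finite principal part -/

section ScalarLaurent

variable {a : ℤ → ℂ} {ℓ : ℤ} {R M : ℝ}

lemma norm_shift_le (hR : 0 < R) (hM : ∀ i, ‖a i‖ * R ^ i ≤ M) (z : ℂ) (m : ℕ) :
    ‖z ^ m * a (ℓ + m)‖ ≤ (M * (R ^ ℓ)⁻¹) * (‖z‖ / R) ^ m := by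
  have h := hM (ℓ + m)
  rw [zpow_add₀ hR.ne', zpow_natCast, ← mul_assoc, ← le_div_iff₀ (by positivity),
    ← le_div_iff₀ (by positivity)] at h
  rw [norm_mul, norm_pow]
  calc ‖z‖ ^ m * ‖a (ℓ + m)‖ ≤ ‖z‖ ^ m * (M / R ^ m / R ^ ℓ) := by
        gcongr
    _ = _ := by rw [div_pow]; field_simp

lemma norm_shift_nonneg (hR : 0 < R) (hM : ∀ i, ‖a i‖ * R ^ i ≤ M) : 0 ≤ M * (R ^ ℓ)⁻¹ :=
  mul_nonneg (le_trans (by positivity) (hM 0)) (by positivity)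

lemma summable_laurent (ha : ∀ i < ℓ, a i = 0) (hR : 0 < R) (hM : ∀ i, ‖a i‖ * R ^ i ≤ M)
    {z : ℂ} (hz : z ≠ 0) (hzR : ‖z‖ < R) : Summable fun i : ℤ => z ^ i * a i := by
  have hinj : Function.Injective fun m : ℕ => ℓ + (m : ℤ) := fun x y h => by simpa using h
  rw [← hinj.summable_iff]
  · have h1 : Summable fun m : ℕ => z ^ m * a (ℓ + m) :=
      Summable.of_norm_bounded ((summable_geometric_of_lt_one (by positivity)
        ((div_lt_one hR).2 hzR)).mul_left _) (norm_shift_le hR hM z)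
    refine (h1.mul_left (z ^ ℓ)).congr fun m => ?_
    simp only [Function.comp, zpow_add₀ hz, zpow_natCast, mul_assoc]
  · intro i hi
    rw [ha i, mul_zero]
    by_contra h
    exact hi ⟨(i - ℓ).toNat, by simp; omega⟩

/-- Factoring out `z ^ ℓ` leaves a power series, which gives analyticity away from 0 and meromorphy
at 0. -/
lemma tsum_laurent (ha : ∀ i < ℓ, a i = 0) {z : ℂ} (hz : z ≠ 0) :
    ∑' i : ℤ, z ^ i * a i = z ^ ℓ * ∑' m : ℕ, z ^ m * a (ℓ + m) := by
  have hinj : Function.Injective fun m : ℕ => ℓ + (m : ℤ) := fun x y h => by simpa using h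
  rw [← tsum_mul_left, ← hinj.tsum_eq]
  · refine tsum_congr fun m => ?_
    simp only [zpow_add₀ hz, zpow_natCast, mul_assoc]
  · intro i hi
    by_contra h
    apply hi
    beta_reduce
    rw [ha i, mul_zero]
    by_contra h'
    exact h ⟨(i - ℓ).toNat, by simp; omega⟩

lemma analyticOnNhd_shift (hR : 0 < R) (hM : ∀ i, ‖a i‖ * R ^ i ≤ M) :
    AnalyticOnNhd ℂ (fun z => ∑' m : ℕ, z ^ m * a (ℓ + m)) (Metric.ball 0 R) := by
  intro z hz
  rw [mem_ball_zero_iff] at hz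
  obtain ⟨r, hzr, hrR⟩ := exists_between hz
  have hr : 0 < r := (norm_nonneg z).trans_lt hzr
  have hd : DifferentiableOn ℂ (fun z => ∑' m : ℕ, z ^ m * a (ℓ + m)) (Metric.ball 0 r) := by
    refine Complex.differentiableOn_tsum_of_summable_norm
      (u := fun m => (M * (R ^ ℓ)⁻¹) * (r / R) ^ m) ?_ (fun m => by fun_prop) Metric.isOpen_ball ?_
    · exact (summable_geometric_of_lt_one (by positivity) ((div_lt_one hR).2 hrR)).mul_left _
    · intro m w hw
      refine (norm_shift_le hR hM w m).trans ?_
      have := norm_shift_nonneg (ℓ := ℓ) hR hM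
      have hw' : ‖w‖ ≤ r := (mem_ball_zero_iff.1 hw).le
      gcongr
  exact hd.analyticAt (Metric.isOpen_ball.mem_nhds (mem_ball_zero_iff.2 hzr))

lemma analyticAt_laurent (ha : ∀ i < ℓ, a i = 0) (hR : 0 < R) (hM : ∀ i, ‖a i‖ * R ^ i ≤ M)
    {z : ℂ} (hz : z ≠ 0) (hzR : ‖z‖ < R) : AnalyticAt ℂ (fun z => ∑' i : ℤ, z ^ i * a i) z := by
  have h1 := analyticOnNhd_shift (ℓ := ℓ) hR hM z (mem_ball_zero_iff.2 hzR)
  have h2 : AnalyticAt ℂ (fun z : ℂ => z ^ ℓ) z := analyticAt_id.zpow hz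
  refine (h2.mul h1).congr ?_
  filter_upwards [isOpen_ne.mem_nhds hz] with w hw
  exact (tsum_laurent ha hw).symm

lemma meromorphicAt_laurent (ha : ∀ i < ℓ, a i = 0) (hR : 0 < R)
    (hM : ∀ i, ‖a i‖ * R ^ i ≤ M) {z : ℂ} (hzR : ‖z‖ < R) :
    MeromorphicAt (fun z => ∑' i : ℤ, z ^ i * a i) z := by
  by_cases hz : z = 0
  · have h1 := (analyticOnNhd_shift (ℓ := ℓ) hR hM z (mem_ball_zero_iff.2 hzR)).meromorphicAt
    have h2 : MeromorphicAt (fun z : ℂ => z ^ ℓ) z := by fun_prop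
    refine (h2.mul h1).congr ?_
    rw [hz]
    filter_upwards [self_mem_nhdsWithin] with w hw
    exact (tsum_laurent ha hw).symm
  · exact (analyticAt_laurent ha hR hM hz hzR).meromorphicAt

end ScalarLaurent

/-! ### Counting zeros minus poles by Jensen's formula -/

lemma meromorphicOrderAt_eq_zero_of_analyticAt {f : ℂ → ℂ} {z : ℂ} (hf : AnalyticAt ℂ f z)
    (h : f z ≠ 0) : meromorphicOrderAt f z = 0 := by
  rw [hf.meromorphicOrderAt_eq, hf.analyticOrderAt_eq_zero.2 h]
  rfl

/-- Jensen's formula on a disk, with the contributions of the divisor collected by radius. -/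
lemma circleAverage_log_norm_eq {f : ℂ → ℂ} {ρ R : ℝ} (hρ : 0 < ρ) (hR : ρ ≤ R)
    (hf : MeromorphicOn f (Metric.closedBall 0 R))
    (hord : ∀ z : ℂ, ρ < ‖z‖ → ‖z‖ ≤ R → meromorphicOrderAt f z = 0)
    {s : Finset ℂ} (h0 : 0 ∈ s)
    (hs : (MeromorphicOn.divisor f (Metric.closedBall 0 R)).support ⊆ s) :
    Real.circleAverage (fun z => Real.log ‖f z‖) 0 ρ =
      ∑ u ∈ s, MeromorphicOn.divisor f (Metric.closedBall 0 R) u *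
        (Real.log ρ + Real.log ‖u‖⁻¹) + Real.log ‖meromorphicTrailingCoeffAt f 0‖ := by
  have hf' : MeromorphicOn f (Metric.closedBall 0 ρ) :=
    hf.mono_set (Metric.closedBall_subset_closedBall hR)
  have hD : ∀ u, MeromorphicOn.divisor f (Metric.closedBall 0 ρ) u =
      MeromorphicOn.divisor f (Metric.closedBall 0 R) u := by
    intro u
    by_cases hu : ‖u‖ ≤ ρ
    · rw [MeromorphicOn.divisor_apply hf' (by simpa using hu),
        MeromorphicOn.divisor_apply hf (by simpa using hu.trans hR)]
    · rw [Function.locallyFinsuppWithin.apply_eq_zero_of_notMem _ (by simpa using hu)]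
      by_cases hu' : ‖u‖ ≤ R
      · rw [MeromorphicOn.divisor_apply hf (by simpa using hu'), hord u (not_le.1 hu) hu']
        rfl
      · rw [Function.locallyFinsuppWithin.apply_eq_zero_of_notMem _ (by simpa using hu')]
  have hJ := MeromorphicOn.circleAverage_log_norm (c := 0) (R := ρ) (f := f) hρ.ne'
    (by rwa [abs_of_pos hρ])
  rw [abs_of_pos hρ] at hJ
  simp only [hD] at hJ
  rw [hJ]
  congr 1
  rw [finsum_eq_sum_of_support_subset (s := s) _ fun u hu => hs fun h => hu (by simp [h])]
  -- Jensen's formula carries the origin in a separate term `D 0 * log ρ`. Since `log ‖0‖⁻¹ = 0` by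
  -- convention, that term is the summand at `u = 0` on the right.
  rw [← Finset.sum_erase_add _ _ h0, ← Finset.sum_erase_add s (fun u =>
    (MeromorphicOn.divisor f (Metric.closedBall 0 R) u : ℝ) * (Real.log ρ + Real.log ‖u‖⁻¹)) h0]
  have : ∀ u ∈ s.erase 0, Real.log (ρ * ‖0 - u‖⁻¹) = Real.log ρ + Real.log ‖u‖⁻¹ := by
    intro u hu
    have hu0 : ‖u‖ ≠ 0 := norm_ne_zero_iff.2 (Finset.ne_of_mem_erase hu)
    rw [zero_sub, norm_neg, Real.log_mul hρ.ne' (inv_ne_zero hu0)]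
  rw [Finset.sum_congr rfl fun u hu => by rw [this u hu]]
  simp

lemma finite_order_ne_zero {f : ℂ → ℂ} {ρ : ℝ} (hf : MeromorphicOn f (Metric.closedBall 0 ρ))
    (htop : ∀ z ∈ Metric.closedBall (0 : ℂ) ρ, meromorphicOrderAt f z ≠ ⊤) :
    {z ∈ Metric.closedBall (0 : ℂ) ρ | meromorphicOrderAt f z ≠ 0}.Finite := by
  refine ((MeromorphicOn.divisor f (Metric.closedBall 0 ρ)).finiteSupport
    (isCompact_closedBall 0 ρ)).subset fun z hz h => hz.2 ?_
  rw [MeromorphicOn.divisor_apply hf hz.1, WithTop.untop₀_eq_zero] at h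
  exact h.resolve_right (htop z hz.1)

/-- The number of zeros minus poles is the slope of the circle averages of `log ‖f‖` as a function
of the logarithm of the radius. -/
lemma circleAverage_log_norm_sub {f : ℂ → ℂ} {r R : ℝ} (hr : 0 < r) (hrR : r ≤ R)
    (hf : MeromorphicOn f (Metric.closedBall 0 R))
    (hord : ∀ z : ℂ, r < ‖z‖ → ‖z‖ ≤ R → meromorphicOrderAt f z = 0) :
    Real.circleAverage (fun z => Real.log ‖f z‖) 0 R -
        Real.circleAverage (fun z => Real.log ‖f z‖) 0 r =
      ((∑ᶠ z ∈ Metric.closedBall (0 : ℂ) r, (meromorphicOrderAt f z).untop₀ : ℤ) : ℝ) *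
        Real.log (R / r) := by
  set D := MeromorphicOn.divisor f (Metric.closedBall 0 R) with hDdef
  have hfin := D.finiteSupport (isCompact_closedBall 0 R)
  set s : Finset ℂ := insert 0 hfin.toFinset with hs
  have hsub : D.support ⊆ s := fun u hu => by
    rw [hs, Finset.mem_coe, Finset.mem_insert]
    exact Or.inr (hfin.mem_toFinset.2 hu)
  have h0 : (0 : ℂ) ∈ s := Finset.mem_insert_self _ _
  rw [circleAverage_log_norm_eq (hr.trans_le hrR) le_rfl hf (fun z h1 h2 => absurd h1 (not_lt.2 h2))
    h0 hsub, circleAverage_log_norm_eq hr hrR hf hord h0 hsub]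
  have hN : ∑ᶠ z ∈ Metric.closedBall (0 : ℂ) r, (meromorphicOrderAt f z).untop₀ =
      ∑ u ∈ s, D u := by
    have : ∀ z, ∑ᶠ (_ : z ∈ Metric.closedBall (0 : ℂ) r), (meromorphicOrderAt f z).untop₀ =
        D z := by
      classical
      intro z
      by_cases hz : z ∈ Metric.closedBall (0 : ℂ) r
      · rw [finsum_eq_if, if_pos hz, hDdef,
          MeromorphicOn.divisor_apply hf (Metric.closedBall_subset_closedBall hrR hz)]
      · rw [finsum_eq_if, if_neg hz]
        by_cases hz' : z ∈ Metric.closedBall (0 : ℂ) R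
        · rw [hDdef, MeromorphicOn.divisor_apply hf hz',
            hord z (by simpa using hz) (by simpa using hz')]
          rfl
        · rw [Function.locallyFinsuppWithin.apply_eq_zero_of_notMem _ hz']
    rw [finsum_congr this, finsum_eq_sum_of_support_subset (s := s) _ hsub]
  -- The trailing coefficient and the terms `log ‖u‖⁻¹` do not depend on the radius and cancel.
  rw [hN, Int.cast_sum, Finset.sum_mul, add_sub_add_right_eq_sub, ← Finset.sum_sub_distrib,
    Real.log_div (hr.trans_le hrR).ne' hr.ne']
  refine Finset.sum_congr rfl fun u _ => by ring

/-- Homotopy invariance of the number of zeros minus poles in a disk. -/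
lemma finsum_order_eq_of_homotopy {H : unitInterval → ℂ → ℂ} {r R : ℝ} (hr : 0 < r) (hrR : r < R)
    (hmer : ∀ t, MeromorphicOn (H t) (Metric.closedBall 0 R))
    (han : ∀ t z, r ≤ ‖z‖ → ‖z‖ ≤ R → AnalyticAt ℂ (H t) z)
    (hne : ∀ t z, r ≤ ‖z‖ → ‖z‖ ≤ R → H t z ≠ 0)
    (hcont : ∀ ρ ∈ Set.Icc r R, Continuous fun q : unitInterval × ℝ => H q.1 (circleMap 0 ρ q.2))
    (t₀ t₁ : unitInterval) :
    ∑ᶠ z ∈ Metric.closedBall (0 : ℂ) r, (meromorphicOrderAt (H t₀) z).untop₀ =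
      ∑ᶠ z ∈ Metric.closedBall (0 : ℂ) r, (meromorphicOrderAt (H t₁) z).untop₀ := by
  set N : unitInterval → ℤ := fun t =>
    ∑ᶠ z ∈ Metric.closedBall (0 : ℂ) r, (meromorphicOrderAt (H t) z).untop₀ with hN
  have hlog : 0 < Real.log (R / r) := Real.log_pos ((one_lt_div hr).2 hrR)
  have hav : ∀ ρ ∈ Set.Icc r R, Continuous fun t =>
      Real.circleAverage (fun z => Real.log ‖H t z‖) 0 ρ := by
    intro ρ hρ
    unfold Real.circleAverage
    apply Continuous.fun_const_smul
    apply intervalIntegral.continuous_parametric_intervalIntegral_of_continuous'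
    refine (hcont ρ hρ).norm.log fun q => norm_ne_zero_iff.2 ?_
    have : ‖circleMap 0 ρ q.2‖ = ρ := by
      rw [norm_circleMap_zero, abs_of_pos (hr.trans_le hρ.1)]
    exact hne _ _ (by rw [this]; exact hρ.1) (by rw [this]; exact hρ.2)
  have hNc : Continuous fun t => (N t : ℝ) := by
    have : (fun t => (N t : ℝ)) = fun t =>
        (Real.circleAverage (fun z => Real.log ‖H t z‖) 0 R -
          Real.circleAverage (fun z => Real.log ‖H t z‖) 0 r) / Real.log (R / r) := by
      ext t
      rw [circleAverage_log_norm_sub hr hrR.le (hmer t) fun z h1 h2 =>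
        meromorphicOrderAt_eq_zero_of_analyticAt (han t z h1.le h2) (hne t z h1.le h2),
        mul_div_cancel_right₀ _ hlog.ne']
    rw [this]
    exact ((hav R ⟨hrR.le, le_rfl⟩).sub (hav r ⟨le_rfl, hrR.le⟩)).div_const _
  have hNc' : Continuous N := Int.isClosedEmbedding_coe_real.continuous_iff.2 hNc
  exact PreconnectedSpace.constant inferInstance hNc'

/-- The slope formula applies directly: the average of `log ‖z ^ m * c‖` over the circle of radius
`ρ` is `m log ρ + log ‖c‖`. The outer radius `2r` is arbitrary. -/
lemma finsum_order_zpow_mul {r : ℝ} (hr : 0 < r) (m : ℤ) {c : ℂ} (hc : c ≠ 0) :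
    ∑ᶠ z ∈ Metric.closedBall (0 : ℂ) r, (meromorphicOrderAt (fun z => z ^ m * c) z).untop₀ = m := by
  have hR : r < 2 * r := by linarith
  have hmer : MeromorphicOn (fun z : ℂ => z ^ m * c) (Metric.closedBall 0 (2 * r)) :=
    fun z _ => by fun_prop
  have h := circleAverage_log_norm_sub hr hR.le hmer fun z h1 _ => by
    have hz : z ≠ 0 := norm_pos_iff.1 (hr.trans h1)
    exact meromorphicOrderAt_eq_zero_of_analyticAt
      ((analyticAt_id.zpow hz).mul analyticAt_const) (mul_ne_zero (zpow_ne_zero _ hz) hc)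
  have hav : ∀ ρ : ℝ, 0 < ρ → Real.circleAverage (fun z : ℂ => Real.log ‖z ^ m * c‖) 0 ρ =
      m * Real.log ρ + Real.log ‖c‖ := by
    intro ρ hρ
    refine Real.circleAverage_const_on_circle fun z hz => ?_
    rw [mem_sphere_zero_iff_norm, abs_of_pos hρ] at hz
    rw [norm_mul, norm_zpow, hz, Real.log_mul (by positivity) (norm_ne_zero_iff.2 hc),
      Real.log_zpow]
  have hlog : 0 < Real.log (2 * r / r) := Real.log_pos ((one_lt_div hr).2 hR)
  rw [hav _ hr, hav _ (by linarith)] at h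
  have h2 : (m : ℝ) * Real.log (2 * r / r) =
      m * Real.log (2 * r) + Real.log ‖c‖ - (m * Real.log r + Real.log ‖c‖) := by
    rw [Real.log_div (by positivity) hr.ne']; ring
  rw [← h2] at h
  exact_mod_cast (mul_right_cancel₀ hlog.ne' h).symm

/-! ### Geometric bound for the non-dominant terms -/

lemma hasSum_two_sided_geometric {ℓ k : ℤ} {u v : ℝ} (hv0 : 0 ≤ v) (hv : v < 1) :
    HasSum (fun i : ℤ => (if i < k ∧ ℓ ≤ i then u ^ (k - i) else 0) +
      if k < i then v ^ (i - k) else 0)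
      (∑ m ∈ Finset.range (k - ℓ).toNat, u ^ (m + 1) + v / (1 - v)) := by
  refine HasSum.add ?_ ?_
  · have hinj : Function.Injective fun m : ℕ => k - 1 - (m : ℤ) := fun x y h => by simpa using h
    rw [← hinj.hasSum_iff]
    · have : ((fun i : ℤ => if i < k ∧ ℓ ≤ i then u ^ (k - i) else 0) ∘
          fun m : ℕ => k - 1 - (m : ℤ)) =
          fun m : ℕ => if m ∈ Finset.range (k - ℓ).toNat then u ^ (m + 1) else 0 := by
        ext m
        have h1 : (k - 1 - (m : ℤ) < k ∧ ℓ ≤ k - 1 - (m : ℤ)) ↔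
            m ∈ Finset.range (k - ℓ).toNat := by
          rw [Finset.mem_range]; omega
        have h2 : k - (k - 1 - (m : ℤ)) = ((m + 1 : ℕ) : ℤ) := by push_cast; ring
        simp only [Function.comp, h1, h2, zpow_natCast]
      rw [this, Finset.sum_congr rfl fun m hm => (if_pos hm).symm]
      exact hasSum_sum_of_ne_finset_zero fun m hm => if_neg hm
    · intro i hi
      rw [if_neg]
      rintro ⟨h1, -⟩
      exact hi ⟨(k - 1 - i).toNat, by simp; omega⟩
  · have hinj : Function.Injective fun m : ℕ => k + 1 + (m : ℤ) := fun x y h => by simpa using h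
    rw [← hinj.hasSum_iff]
    · have : ((fun i : ℤ => if k < i then v ^ (i - k) else 0) ∘ fun m : ℕ => k + 1 + (m : ℤ)) =
          fun m : ℕ => v * v ^ m := by
        ext m
        have h2 : k + 1 + (m : ℤ) - k = ((m + 1 : ℕ) : ℤ) := by push_cast; ring
        simp only [Function.comp, h2, zpow_natCast]
        rw [if_pos (by omega), pow_succ']
      rw [this, div_eq_mul_inv]
      exact (hasSum_geometric_of_lt_one hv0 hv).mul_left v
    · intro i hi
      rw [if_neg]
      intro h1
      exact hi ⟨(i - k - 1).toNat, by simp; omega⟩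

/-- The bound, on the circle of radius `ρ`, for the ratio of the other terms of a matrix Laurent
series to the term of a vertex which dominates between the radii `a` and `c`. -/
noncomputable def tailRatio (N : ℕ) (κ a c ρ : ℝ) : ℝ :=
  κ * (∑ m ∈ Finset.range N, (a / ρ) ^ (m + 1) + ρ / c / (1 - ρ / c))

/-- The value `x = (1+2κ)⁻¹` solves `x/(1-x) = 1/(2κ)`, so each side contributes at most `1/(2κ)`.
Strictness, even at the end radii, comes from the lower side being a finite geometric sum. -/
lemma tailRatio_lt_one {N : ℕ} {κ a c ρ : ℝ} (hκ : 0 < κ) (ha : 0 < a) (hc : 0 < c)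
    (h1 : (1 + 2 * κ) * a ≤ ρ) (h2 : ρ ≤ (1 + 2 * κ)⁻¹ * c) : tailRatio N κ a c ρ < 1 := by
  have hρ : 0 < ρ := lt_of_lt_of_le (by positivity) h1
  have hw : 0 < 1 + 2 * κ := by positivity
  have key : ∀ x : ℝ, x ≤ (1 + 2 * κ)⁻¹ → x < 1 ∧ x / (1 - x) ≤ 1 / (2 * κ) := by
    intro x hx
    have h3 : x * (1 + 2 * κ) ≤ 1 := by rwa [← le_div_iff₀ hw, one_div]
    have h4 : x < 1 := by
      by_contra h
      nlinarith [not_lt.1 h]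
    refine ⟨h4, ?_⟩
    rw [div_le_div_iff₀ (by linarith) (by positivity)]
    linarith
  have hu0 : 0 < a / ρ := by positivity
  obtain ⟨hu1, hu⟩ := key (a / ρ) (by
    rw [div_le_iff₀ hρ, inv_mul_eq_div, le_div_iff₀ hw]; linarith)
  obtain ⟨hv1, hv⟩ := key (ρ / c) (by rwa [div_le_iff₀ hc])
  have hsum : ∑ m ∈ Finset.range N, (a / ρ) ^ (m + 1) < a / ρ / (1 - a / ρ) := by
    -- Keeping one extra positive term makes the comparison with the full series strict.
    have h5 := Summable.sum_le_tsum (Finset.range (N + 1))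
      (fun m _ => (pow_pos hu0 (m + 1)).le)
      ((summable_nat_add_iff 1).2 (summable_geometric_of_lt_one hu0.le hu1))
    rw [Finset.sum_range_succ] at h5
    refine (lt_of_lt_of_le (lt_add_of_pos_right _ (pow_pos hu0 (N + 1))) h5).trans_eq ?_
    rw [tsum_congr fun m => pow_succ' (a / ρ) m, tsum_mul_left,
      tsum_geometric_of_lt_one hu0.le hu1, ← div_eq_mul_inv]
  unfold tailRatio
  calc κ * (∑ m ∈ Finset.range N, (a / ρ) ^ (m + 1) + ρ / c / (1 - ρ / c))
      < κ * (1 / (2 * κ) + 1 / (2 * κ)) :=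
        mul_lt_mul_of_pos_left (add_lt_add_of_lt_of_le (hsum.trans_le hu) hv) hκ
    _ = 1 := by field_simp; norm_num

lemma continuousAt_tailRatio {N : ℕ} {κ a c ρ : ℝ} (hρ : 0 < ρ) (hρc : ρ < c) :
    ContinuousAt (tailRatio N κ a c) ρ := by
  have hc : 0 < c := hρ.trans hρc
  have h1 : 1 - ρ / c ≠ 0 := by
    have := (div_lt_one hc).2 hρc
    linarith
  unfold tailRatio
  have h2 : ContinuousAt (fun ρ : ℝ => a / ρ) ρ := continuousAt_const.div continuousAt_id hρ.ne'
  have h3 : ContinuousAt (fun ρ : ℝ => ρ / c) ρ := continuousAt_id.div_const c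
  refine continuousAt_const.mul (ContinuousAt.add ?_ (h3.div (continuousAt_const.sub h3) h1))
  exact tendsto_finsetSum _ fun m _ => (h2.pow (m + 1))

/-! ### Matrix series with a dominant coefficient -/

lemma analyticAt_det {n : ℕ} {A : ℂ → Matrix (Fin n) (Fin n) ℂ} {z : ℂ}
    (h : ∀ i j, AnalyticAt ℂ (fun w => A w i j) z) : AnalyticAt ℂ (fun w => (A w).det) z := by
  simp only [Matrix.det_apply']
  exact Finset.analyticAt_fun_sum _ fun σ _ => analyticAt_const.mul
    (Finset.analyticAt_fun_prod _ fun i _ => h _ _)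

lemma meromorphicAt_det {n : ℕ} {A : ℂ → Matrix (Fin n) (Fin n) ℂ} {z : ℂ}
    (h : ∀ i j, MeromorphicAt (fun w => A w i j) z) : MeromorphicAt (fun w => (A w).det) z := by
  simp only [Matrix.det_apply']
  exact MeromorphicAt.fun_sum fun σ _ => (MeromorphicAt.const _ _).mul
    (MeromorphicAt.fun_prod fun i _ => h _ _)

lemma isEigenvalue_iff {n : ℕ} {F : ℂ → Matrix (Fin n) (Fin n) ℂ} {z : ℂ} :
    IsEigenvalue F z ↔ (F z).det = 0 :=
  Matrix.exists_mulVec_eq_zero_iff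

/-- The index `k`, with nonsingular coefficient, dominates a matrix Laurent series with coefficients
vanishing below `ℓ` on the circles of radii `a < c`. -/
structure IsDominantIndex {n : ℕ} (p : Seminorm ℂ (Fin n → ℂ)) (B : ℤ → Matrix (Fin n) (Fin n) ℂ)
    (ℓ : ℤ) (a c : ℝ) (k : ℤ) : Prop where
  eq_zero : ∀ x, p x = 0 → x = 0
  bot : ∀ i < ℓ, B i = 0
  pos : 0 < a
  lt : a < c
  coeff_pos : 0 < subNorm p (B k)
  isUnit : IsUnit (B k).det
  le_left : ∀ i, subNorm p (B i) * a ^ i ≤ subNorm p (B k) * a ^ k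
  le_right : ∀ i, subNorm p (B i) * c ^ i ≤ subNorm p (B k) * c ^ k

namespace IsDominantIndex

variable {n : ℕ} {p : Seminorm ℂ (Fin n → ℂ)} {B : ℤ → Matrix (Fin n) (Fin n) ℂ}
  {ℓ : ℤ} {a c : ℝ} {k : ℤ} (h : IsDominantIndex p B ℓ a c k)
include h

lemma pos_right : 0 < c := h.pos.trans h.lt

/-- As the principal part is finite, this bound at the outer radius suffices for convergence on `0 <
‖z‖ < c`. -/
lemma exists_entry_bound : ∃ M : ℝ, ∀ i r s, ‖B i r s‖ * c ^ i ≤ M := by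
  obtain ⟨K, hK, hKB⟩ := exists_norm_entry_le h.eq_zero
  refine ⟨K * (subNorm p (B k) * c ^ k), fun i r s => ?_⟩
  have hc := h.pos_right
  calc ‖B i r s‖ * c ^ i ≤ K * subNorm p (B i) * c ^ i := by gcongr; exact hKB _ _ _
    _ = K * (subNorm p (B i) * c ^ i) := mul_assoc _ _ _
    _ ≤ _ := mul_le_mul_of_nonneg_left (h.le_right i) hK

lemma hasSum_laurentSum {z : ℂ} (hz : z ≠ 0) (hzc : ‖z‖ < c) :
    HasSum (fun i : ℤ => z ^ i • B i) (laurentSum B z) := by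
  obtain ⟨M, hM⟩ := h.exists_entry_bound
  refine Summable.hasSum ?_
  refine Pi.summable.2 fun r => Pi.summable.2 fun s => ?_
  exact summable_laurent (a := fun i => B i r s) (ℓ := ℓ) (fun i hi => by simp [h.bot i hi])
    h.pos_right (fun i => hM i r s) hz hzc

lemma laurentSum_apply {z : ℂ} (hz : z ≠ 0) (hzc : ‖z‖ < c) (r s : Fin n) :
    laurentSum B z r s = ∑' i : ℤ, z ^ i * B i r s :=
  ((Pi.hasSum.1 (Pi.hasSum.1 (h.hasSum_laurentSum hz hzc) r) s).tsum_eq).symm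

lemma analyticAt_apply {z : ℂ} (hz : z ≠ 0) (hzc : ‖z‖ < c) (r s : Fin n) :
    AnalyticAt ℂ (fun w => laurentSum B w r s) z := by
  obtain ⟨M, hM⟩ := h.exists_entry_bound
  refine (analyticAt_laurent (a := fun i => B i r s) (ℓ := ℓ) (fun i hi => by simp [h.bot i hi])
    h.pos_right (fun i => hM i r s) hz hzc).congr ?_
  filter_upwards [isOpen_ne.mem_nhds hz,
    Metric.isOpen_ball.mem_nhds (mem_ball_zero_iff.2 hzc)] with w hw hwc
  exact (h.laurentSum_apply hw (mem_ball_zero_iff.1 hwc) r s).symm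

lemma meromorphicAt_apply {z : ℂ} (hzc : ‖z‖ < c) (r s : Fin n) :
    MeromorphicAt (fun w => laurentSum B w r s) z := by
  obtain ⟨M, hM⟩ := h.exists_entry_bound
  refine (meromorphicAt_laurent (a := fun i => B i r s) (ℓ := ℓ) (fun i hi => by simp [h.bot i hi])
    h.pos_right (fun i => hM i r s) hzc).congr ?_
  have hne : ∀ᶠ w in 𝓝[≠] z, w ≠ 0 := by
    by_cases hz : z = 0
    · rw [hz]; exact self_mem_nhdsWithin
    · exact nhdsWithin_le_nhds (isOpen_ne.mem_nhds hz)
  filter_upwards [hne, nhdsWithin_le_nhds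
    (Metric.isOpen_ball.mem_nhds (mem_ball_zero_iff.2 hzc))] with w hw hwc
  exact (h.laurentSum_apply hw (mem_ball_zero_iff.1 hwc) r s).symm

/-- Moving the comparison with index `k` from radius `e` to `ρ` costs a factor `(ρ/e)^(i-k)`; take
`e = a` for `i < k` and `e = c` for `i > k`. -/
lemma norm_term_le {i : ℤ} (hi : i ≠ k) {ρ : ℝ} (hρ : 0 < ρ) :
    subNorm p (B i) * ρ ^ i ≤ subNorm p (B k) * ρ ^ k *
      ((if i < k ∧ ℓ ≤ i then (a / ρ) ^ (k - i) else 0) +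
        if k < i then (ρ / c) ^ (i - k) else 0) := by
  have ha := h.pos
  have hc := h.pos_right
  have hbk := h.coeff_pos
  have key : ∀ e : ℝ, 0 < e → subNorm p (B i) * e ^ i ≤ subNorm p (B k) * e ^ k →
      subNorm p (B i) * ρ ^ i ≤ subNorm p (B k) * ρ ^ k * (ρ / e) ^ (i - k) := by
    intro e he hle
    rw [← le_div_iff₀ (by positivity)] at hle
    calc subNorm p (B i) * ρ ^ i ≤ subNorm p (B k) * e ^ k / e ^ i * ρ ^ i := by gcongr
      _ = _ := by
        rw [div_zpow, zpow_sub₀ hρ.ne', zpow_sub₀ he.ne']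
        field_simp
  rcases lt_or_gt_of_ne hi with hik | hik
  · rw [if_neg (not_lt.2 hik.le), add_zero]
    by_cases hℓ : ℓ ≤ i
    · rw [if_pos ⟨hik, hℓ⟩, ← neg_sub i k, zpow_neg, ← inv_zpow, inv_div]
      exact key a ha (h.le_left i)
    · rw [h.bot i (not_le.1 hℓ), subNorm_zero, if_neg (fun h => hℓ h.2)]
      simp
  · rw [if_neg (fun h => not_lt.2 hik.le h.1), zero_add, if_pos hik]
    exact key c hc (h.le_right i)

lemma seminorm_sub_le {z : ℂ} (hza : z ≠ 0) (hzc : ‖z‖ < c) (v : Fin n → ℂ) :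
    p ((laurentSum B z).mulVec v - (z ^ k • B k).mulVec v) ≤
      subNorm p (B k) * ‖z‖ ^ k * (∑ m ∈ Finset.range (k - ℓ).toNat, (a / ‖z‖) ^ (m + 1) +
        ‖z‖ / c / (1 - ‖z‖ / c)) * p v := by
  have hρ : 0 < ‖z‖ := norm_pos_iff.2 hza
  have hc := h.pos_right
  have hF : HasSum (fun i : ℤ => (z ^ i • B i).mulVec v) ((laurentSum B z).mulVec v) :=
    (h.hasSum_laurentSum hza hzc).map
      (AddMonoidHom.mk' (fun A : Matrix (Fin n) (Fin n) ℂ => A.mulVec v)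
        fun A A' => Matrix.add_mulVec A A' v) (continuous_id.matrix_mulVec continuous_const)
  have hF' := hF.sub (hasSum_ite_eq k ((z ^ k • B k).mulVec v))
  refine seminorm_le_of_hasSum hF' (((hasSum_two_sided_geometric (ℓ := ℓ) (k := k) (u := a / ‖z‖)
    (by positivity) ((div_lt_one hc).2 hzc)).mul_left (subNorm p (B k) * ‖z‖ ^ k)).mul_right
      (p v)) fun i => ?_
  by_cases hi : i = k
  · subst hi
    simp
  · rw [if_neg hi, sub_zero, Matrix.smul_mulVec, map_smul_eq_mul, norm_zpow]
    calc ‖z‖ ^ i * p ((B i).mulVec v) ≤ ‖z‖ ^ i * (subNorm p (B i) * p v) := by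
          gcongr; exact seminorm_mulVec_le h.eq_zero _ _
      _ = (subNorm p (B i) * ‖z‖ ^ i) * p v := by ring
      _ ≤ _ := by
          refine mul_le_mul_of_nonneg_right (h.norm_term_le hi hρ) (apply_nonneg p v)

/-- Where the tail ratio is less than one, the whole segment of matrices between the dominant term
and the series is nonsingular. -/
lemma det_segment_ne_zero {z : ℂ} (hza : z ≠ 0) (hzc : ‖z‖ < c)
    (hlt : tailRatio (k - ℓ).toNat (cond p (B k)) a c ‖z‖ < 1) {t : ℝ} (ht : t ∈ Set.Icc (0 : ℝ) 1) :
    ((1 - (t : ℂ)) • z ^ k • B k + (t : ℂ) • laurentSum B z).det ≠ 0 := by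
  intro hdet
  obtain ⟨v, hv, hMv⟩ := Matrix.exists_mulVec_eq_zero_iff.2 hdet
  have hpv : 0 < p v := lt_of_le_of_ne (apply_nonneg p _) fun h0 => hv (h.eq_zero _ h0.symm)
  have hρ : 0 < ‖z‖ := norm_pos_iff.2 hza
  set w := (laurentSum B z).mulVec v - (z ^ k • B k).mulVec v with hw
  -- A kernel vector `v` balances the dominant term against `t` times the tail `w`; bounding `p v`
  -- through `(B k)⁻¹` and the tail ratio then yields `p v < p v`, up to the factor `‖z‖ ^ k`.
  have hzB : z ^ k • (B k).mulVec v = -((t : ℂ) • w) := by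
    rw [hw, eq_neg_iff_add_eq_zero, ← hMv]
    simp only [Matrix.add_mulVec, Matrix.sub_mulVec, Matrix.smul_mulVec, sub_smul, smul_sub, one_smul]
    abel
  have h1 : ‖z‖ ^ k * p ((B k).mulVec v) = t * p w := by
    have := congrArg p hzB
    rwa [map_neg_eq_map, map_smul_eq_mul, map_smul_eq_mul, norm_zpow, Complex.norm_real,
      Real.norm_of_nonneg ht.1] at this
  have h2 : p v ≤ subNorm p (B k)⁻¹ * p ((B k).mulVec v) := by
    have := seminorm_mulVec_le h.eq_zero (B k)⁻¹ ((B k).mulVec v)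
    rwa [Matrix.mulVec_mulVec, Matrix.nonsing_inv_mul _ h.isUnit, Matrix.one_mulVec] at this
  have h3 := h.seminorm_sub_le hza hzc v
  have hpw : t * p w ≤ p w := mul_le_of_le_one_left (apply_nonneg p _) ht.2
  set S := ∑ m ∈ Finset.range (k - ℓ).toNat, (a / ‖z‖) ^ (m + 1) + ‖z‖ / c / (1 - ‖z‖ / c)
    with hS
  have hρk : 0 < ‖z‖ ^ k := by positivity
  have h4 : ‖z‖ ^ k * p v < ‖z‖ ^ k * p v := by
    calc ‖z‖ ^ k * p v ≤ ‖z‖ ^ k * (subNorm p (B k)⁻¹ * p ((B k).mulVec v)) := by gcongr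
      _ = subNorm p (B k)⁻¹ * (‖z‖ ^ k * p ((B k).mulVec v)) := by ring
      _ ≤ subNorm p (B k)⁻¹ * (subNorm p (B k) * ‖z‖ ^ k * S * p v) := by
          rw [h1]
          exact mul_le_mul_of_nonneg_left (hpw.trans h3) (subNorm_nonneg _)
      _ = (‖z‖ ^ k * p v) * tailRatio (k - ℓ).toNat (cond p (B k)) a c ‖z‖ := by
          rw [tailRatio, cond, ← hS]; ring
      _ < (‖z‖ ^ k * p v) * 1 := by gcongr
      _ = _ := mul_one _
  exact lt_irrefl _ h4

lemma det_ne_zero {z : ℂ} (hza : z ≠ 0) (hzc : ‖z‖ < c)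
    (hlt : tailRatio (k - ℓ).toNat (cond p (B k)) a c ‖z‖ < 1) : (laurentSum B z).det ≠ 0 := by
  simpa using h.det_segment_ne_zero hza hzc hlt (t := 1) ⟨zero_le_one, le_rfl⟩

lemma analyticAt_det {z : ℂ} (hz : z ≠ 0) (hzc : ‖z‖ < c) :
    AnalyticAt ℂ (fun w => (laurentSum B w).det) z :=
  TropLaurent.analyticAt_det (h.analyticAt_apply hz hzc)

lemma meromorphicAt_det {z : ℂ} (hzc : ‖z‖ < c) :
    MeromorphicAt (fun w => (laurentSum B w).det) z :=
  TropLaurent.meromorphicAt_det (h.meromorphicAt_apply hzc)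

lemma finsum_order_eq {r : ℝ} (hr : 0 < r) (hrc : r < c)
    (hlt : tailRatio (k - ℓ).toNat (cond p (B k)) a c r < 1) :
    ∑ᶠ z ∈ Metric.closedBall (0 : ℂ) r,
      (meromorphicOrderAt (fun w => (laurentSum B w).det) z).untop₀ = n * k := by
  -- The slope formula needs an annulus of positive width, whereas the admissible radii may reduce
  -- to one circle. The strict inequality persists up to some `R' > r`.
  have hev : ∀ᶠ ρ in 𝓝 r, tailRatio (k - ℓ).toNat (cond p (B k)) a c ρ < 1 ∧ ρ < c :=
    ((continuousAt_tailRatio hr hrc).eventually (eventually_lt_nhds hlt)).and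
      (eventually_lt_nhds hrc)
  obtain ⟨R', hR', hsub⟩ := mem_nhdsGE_iff_exists_Icc_subset.1
    (nhdsWithin_le_nhds (s := Set.Ici r) hev)
  have hrR : r < R' := hR'
  have hz0 : ∀ z : ℂ, r ≤ ‖z‖ → z ≠ 0 := fun z hz => norm_pos_iff.1 (hr.trans_le hz)
  let H : unitInterval → ℂ → ℂ := fun t z =>
    ((1 - ((t : ℝ) : ℂ)) • z ^ k • B k + ((t : ℝ) : ℂ) • laurentSum B z).det
  have hR'c : R' < c := (hsub ⟨hrR.le, le_rfl⟩).2
  have key := finsum_order_eq_of_homotopy (H := H) hr hrR ?_ ?_ ?_ ?_ 1 0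
  · have e1 : H 1 = fun w => (laurentSum B w).det := by
      ext w; simp [H]
    have e0 : H 0 = fun w => w ^ ((n : ℤ) * k) * (B k).det := by
      ext w
      simp only [H, Set.Icc.coe_zero, Complex.ofReal_zero, sub_zero, one_smul, zero_smul, add_zero,
        Matrix.det_smul, Fintype.card_fin]
      rw [mul_comm (n : ℤ) k, zpow_mul, zpow_natCast]
    rw [e1, e0, finsum_order_zpow_mul hr _ h.isUnit.ne_zero] at key
    exact key
  · intro t z hz
    refine TropLaurent.meromorphicAt_det fun i j => ?_
    have hm := h.meromorphicAt_apply ((mem_closedBall_zero_iff.1 hz).trans_lt hR'c) i j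
    simp only [Matrix.add_apply, Matrix.smul_apply, smul_eq_mul]
    fun_prop
  · intro t z h1 h2
    refine TropLaurent.analyticAt_det fun i j => ?_
    have hm := h.analyticAt_apply (hz0 z h1) (h2.trans_lt hR'c) i j
    have hk : AnalyticAt ℂ (fun w : ℂ => w ^ k) z := analyticAt_id.zpow (hz0 z h1)
    simp only [Matrix.add_apply, Matrix.smul_apply, smul_eq_mul]
    fun_prop
  · intro t z h1 h2
    exact h.det_segment_ne_zero (hz0 z h1) (h2.trans_lt hR'c) (hsub ⟨h1, h2⟩).1 t.2
  · intro ρ hρ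
    have hρ0 : 0 < ρ := hr.trans_le hρ.1
    have hcirc : ∀ θ, ‖circleMap 0 ρ θ‖ = ρ := fun θ => by
      rw [norm_circleMap_zero, abs_of_pos hρ0]
    have hFc : Continuous fun q : unitInterval × ℝ => laurentSum B (circleMap 0 ρ q.2) := by
      refine continuous_matrix fun i j => continuous_iff_continuousAt.2 fun q => ?_
      have h1 := (h.analyticAt_apply (z := circleMap 0 ρ q.2)
        (hz0 _ (by rw [hcirc]; exact hρ.1)) (by rw [hcirc]; exact hρ.2.trans_lt hR'c) i j).continuousAt
      exact h1.comp (f := fun q : unitInterval × ℝ => circleMap 0 ρ q.2)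
        ((continuous_circleMap 0 ρ).comp continuous_snd).continuousAt
    have hzc : Continuous fun q : unitInterval × ℝ => circleMap 0 ρ q.2 ^ k :=
      ((continuous_circleMap 0 ρ).comp continuous_snd).zpow₀ k fun q =>
        Or.inl (hz0 _ (hρ.1.trans_eq (hcirc q.2).symm))
    have htc : Continuous fun q : unitInterval × ℝ => ((q.1 : ℝ) : ℂ) :=
      Complex.continuous_ofReal.comp (continuous_subtype_val.comp continuous_fst)
    exact ((((continuous_const.sub htc).smul (hzc.smul continuous_const)).add
      (htc.smul hFc))).matrix_det

/-- The disk is connected, so nonvanishing of the determinant at the point `r` rules out infinite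
order anywhere in it. -/
lemma order_ne_top {r : ℝ} (hr : 0 < r) (hrc : r < c)
    (hlt : tailRatio (k - ℓ).toNat (cond p (B k)) a c r < 1) {z : ℂ} (hzc : ‖z‖ < c) :
    meromorphicOrderAt (fun w => (laurentSum B w).det) z ≠ ⊤ := by
  have hmer : MeromorphicOn (fun w => (laurentSum B w).det) (Metric.ball 0 c) := fun w hw =>
    h.meromorphicAt_det (mem_ball_zero_iff.1 hw)
  have hr' : ‖(r : ℂ)‖ = r := by rw [Complex.norm_real, Real.norm_of_nonneg hr.le]
  have hr0 : (r : ℂ) ≠ 0 := by exact_mod_cast hr.ne'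
  refine hmer.meromorphicOrderAt_ne_top_of_isPreconnected (x := (r : ℂ))
    (convex_ball (0 : ℂ) c).isPreconnected (mem_ball_zero_iff.2 (by rwa [hr']))
    (mem_ball_zero_iff.2 hzc) ?_
  rw [meromorphicOrderAt_eq_zero_of_analyticAt (h.analyticAt_det hr0 (by rwa [hr']))
    (h.det_ne_zero hr0 (by rwa [hr']) (by rwa [hr']))]
  exact WithTop.zero_ne_top

end IsDominantIndex

namespace IsDominantIndex

variable {n : ℕ} {p : Seminorm ℂ (Fin n → ℂ)} {B : ℤ → Matrix (Fin n) (Fin n) ℂ}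
  {ℓ : ℤ} {a c : ℝ} {k : ℤ} (h : IsDominantIndex p B ℓ a c k)
include h

lemma cond_pos : 0 < cond p (B k) := TropLaurent.cond_pos h.eq_zero h.isUnit h.coeff_pos

lemma inv_mul_lt : (1 + 2 * cond p (B k))⁻¹ * c < c := by
  have hκ := h.cond_pos
  exact mul_lt_of_lt_one_left h.pos_right (inv_lt_one_of_one_lt₀ (by linarith))

lemma lt_mul : a < (1 + 2 * cond p (B k)) * a := by
  have hκ := h.cond_pos
  exact lt_mul_of_one_lt_left h.pos (by linarith)

lemma not_isEigenvalue {z : ℂ} (h1 : (1 + 2 * cond p (B k)) * a ≤ ‖z‖)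
    (h2 : ‖z‖ ≤ (1 + 2 * cond p (B k))⁻¹ * c) : ¬ IsEigenvalue (laurentSum B) z := by
  rw [isEigenvalue_iff]
  have hz : z ≠ 0 := norm_pos_iff.1 ((h.pos.trans h.lt_mul).trans_le h1)
  exact h.det_ne_zero hz (h2.trans_lt h.inv_mul_lt)
    (tailRatio_lt_one h.cond_pos h.pos h.pos_right h1 h2)

variable (hgap : (1 + 2 * cond p (B k)) * a ≤ (1 + 2 * cond p (B k))⁻¹ * c)
include hgap

lemma hasEigenvaluesMinusPoles :
    HasEigenvaluesMinusPoles (laurentSum B) {z : ℂ | ‖z‖ ≤ (1 + 2 * cond p (B k)) * a}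
      (n * k) := by
  have hr : 0 < (1 + 2 * cond p (B k)) * a := h.pos.trans h.lt_mul
  have hrc : (1 + 2 * cond p (B k)) * a < c := hgap.trans_lt h.inv_mul_lt
  have hlt := tailRatio_lt_one (N := (k - ℓ).toNat) h.cond_pos h.pos h.pos_right le_rfl hgap
  have hset : {z : ℂ | ‖z‖ ≤ (1 + 2 * cond p (B k)) * a} =
      Metric.closedBall 0 ((1 + 2 * cond p (B k)) * a) := by
    ext z; simp
  rw [hset]
  have hmer : MeromorphicOn (fun z => (laurentSum B z).det)
      (Metric.closedBall 0 ((1 + 2 * cond p (B k)) * a)) := fun z hz =>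
    h.meromorphicAt_det ((mem_closedBall_zero_iff.1 hz).trans_lt hrc)
  have htop : ∀ z ∈ Metric.closedBall (0 : ℂ) ((1 + 2 * cond p (B k)) * a),
      meromorphicOrderAt (fun z => (laurentSum B z).det) z ≠ ⊤ := fun z hz =>
    h.order_ne_top hr hrc hlt ((mem_closedBall_zero_iff.1 hz).trans_lt hrc)
  exact ⟨hmer, htop, finite_order_ne_zero hmer htop, h.finsum_order_eq hr hrc hlt⟩

end IsDominantIndex

/-- Zeros of an analytic determinant are counted by its meromorphic orders. -/
lemma hasEigenvalues_of_finsum_order {n : ℕ} {F : ℂ → Matrix (Fin n) (Fin n) ℂ} {S : Set ℂ}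
    {N : ℤ} (han : AnalyticOnNhd ℂ (fun z => (F z).det) S)
    (htop : ∀ z ∈ S, meromorphicOrderAt (fun z => (F z).det) z ≠ ⊤)
    (hfin : {z ∈ S | meromorphicOrderAt (fun z => (F z).det) z ≠ 0}.Finite)
    (hN : ∑ᶠ z ∈ S, (meromorphicOrderAt (fun z => (F z).det) z).untop₀ = N) :
    HasEigenvalues F S N := by
  have htop' : ∀ z ∈ S, analyticOrderAt (fun z => (F z).det) z ≠ ⊤ := fun z hz h => by
    apply htop z hz
    rw [(han z hz).meromorphicOrderAt_eq, h]
    rfl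
  have hord : ∀ z ∈ S, (meromorphicOrderAt (fun z => (F z).det) z).untop₀ =
      (analyticOrderNatAt (fun z => (F z).det) z : ℤ) := fun z hz => by
    rw [(han z hz).meromorphicOrderAt_eq, ← Nat.cast_analyticOrderNatAt (htop' z hz)]
    rfl
  have heig : ∀ z ∈ S, IsEigenvalue F z ↔ analyticOrderNatAt (fun z => (F z).det) z ≠ 0 :=
    fun z hz => by
      rw [isEigenvalue_iff, ← not_iff_not, not_not, ← ne_eq,
        ← (han z hz).analyticOrderAt_eq_zero, ← Nat.cast_analyticOrderNatAt (htop' z hz),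
        Nat.cast_eq_zero]
  have hfinE : {z ∈ S | IsEigenvalue F z}.Finite := by
    refine hfin.subset fun z hz => ⟨hz.1, fun h0 => (heig z hz.1).1 hz.2 ?_⟩
    have h1 := hord z hz.1
    rw [h0, WithTop.untop₀_zero] at h1
    exact_mod_cast h1.symm
  refine ⟨han, htop', hfinE, ?_⟩
  have hcast := AddMonoidHom.map_finsum_mem
    (fun z => analyticOrderNatAt (fun z => (F z).det) z) (Nat.castAddMonoidHom ℤ) hfinE
  simp only [Nat.coe_castAddMonoidHom] at hcast
  rw [hcast, ← hN, finsum_mem_congr rfl hord]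
  refine finsum_mem_inter_support_eq' _ _ _ fun z hz =>
    ⟨fun h => h.1, fun h => ⟨h, (heig z h).2 fun h0 => hz (by simp [h0])⟩⟩

/-- The counts in the disks of radii `R` and `r` are subtracted. The annulus avoids 0, so the
determinant is analytic on it and the difference counts zeros only. -/
lemma IsDominantIndex.hasEigenvalues {n : ℕ} {p : Seminorm ℂ (Fin n → ℂ)}
    {B : ℤ → Matrix (Fin n) (Fin n) ℂ} {ℓ : ℤ} {a c a' c' : ℝ} {k k' : ℤ}
    (h : IsDominantIndex p B ℓ a c k) (h' : IsDominantIndex p B ℓ a' c' k') (hca : c ≤ a')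
    (hgap : (1 + 2 * cond p (B k)) * a ≤ (1 + 2 * cond p (B k))⁻¹ * c)
    (hgap' : (1 + 2 * cond p (B k')) * a' ≤ (1 + 2 * cond p (B k'))⁻¹ * c') :
    HasEigenvalues (laurentSum B)
      {z : ℂ | (1 + 2 * cond p (B k))⁻¹ * c ≤ ‖z‖ ∧ ‖z‖ ≤ (1 + 2 * cond p (B k')) * a'}
      (n * (k' - k)) := by
  set r := (1 + 2 * cond p (B k)) * a
  set q := (1 + 2 * cond p (B k))⁻¹ * c
  set R := (1 + 2 * cond p (B k')) * a'
  have hr : 0 < r := h.pos.trans h.lt_mul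
  have hqR : q < R := h.inv_mul_lt.trans_le (hca.trans h'.lt_mul.le)
  have hR : R < c' := hgap'.trans_lt h'.inv_mul_lt
  obtain ⟨-, -, -, hsum⟩ := h.hasEigenvaluesMinusPoles hgap
  obtain ⟨-, htop, hfin, hsum'⟩ := h'.hasEigenvaluesMinusPoles hgap'
  have hsub : {z : ℂ | ‖z‖ ≤ r} ⊆ {z : ℂ | ‖z‖ ≤ R} := fun z hz =>
    le_trans hz (hgap.trans hqR.le)
  have hzero : ∀ z : ℂ, r ≤ ‖z‖ → ‖z‖ ≤ q →
      meromorphicOrderAt (fun z => (laurentSum B z).det) z = 0 := fun z h1 h2 =>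
    meromorphicOrderAt_eq_zero_of_analyticAt
      (h.analyticAt_det (norm_pos_iff.1 (hr.trans_le h1)) (h2.trans_lt h.inv_mul_lt))
      fun h0 => h.not_isEigenvalue h1 h2 (isEigenvalue_iff.2 h0)
  have hdiff := finsum_mem_add_sdiff' hsub (f := fun z =>
    (meromorphicOrderAt (fun z => (laurentSum B z).det) z).untop₀)
    (hfin.subset fun z hz => ⟨hz.1, fun h0 => hz.2 (by simp [h0])⟩)
  rw [hsum, hsum'] at hdiff
  refine hasEigenvalues_of_finsum_order
    (fun z hz => h'.analyticAt_det (norm_pos_iff.1 (hr.trans_le (hgap.trans hz.1)))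
      (lt_of_le_of_lt hz.2 hR))
    (fun z hz => htop z hz.2) (hfin.subset fun z hz => ⟨hz.1.2, hz.2⟩) ?_
  rw [mul_sub, ← hdiff, add_sub_cancel_left]
  -- The annulus and the difference of disks differ only within `r ≤ ‖z‖ ≤ q`, where all orders
  -- vanish; this covers the shared circle when `r = q`.
  refine finsum_mem_inter_support_eq' _ _ _ fun z hz => ⟨fun hS => ⟨hS.2, fun hzr => ?_⟩,
    fun hD => ⟨?_, hD.1⟩⟩
  · exact hz (by simp [hzero z (hgap.trans hS.1) (le_trans hzr hgap)])
  · by_contra hq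
    exact hz (by simp [hzero z (not_le.1 hD.2).le (not_le.1 hq).le])

end TropLaurent

/-! ### The localization theorem -/

theorem theorem3p10 {n : ℕ}
    (p : Seminorm ℂ (Fin n → ℂ)) (hp : ∀ x, p x = 0 → x = 0)
    (B : ℤ → Matrix (Fin n) (Fin n) ℂ) (ℓ : ℤ) (hℓ : ∀ j < ℓ, B j = 0)
    (b : ℤ → ℝ) (hb : ∀ j, b j = TropLaurent.subNorm p (B j))
    (hreg : ∃ z ∈ TropLaurent.convAnnulus b, (TropLaurent.laurentSum B z).det ≠ 0)
    (T : Set ℤ) (α : ℤ → ℝ) (hα : TropLaurent.IsRootSequence b T α)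
    (k : ℤ → ℤ) (hk : ∀ j ∈ T, k j = TropLaurent.rightVertex b (-Real.log (α j)))
    (κ : ℤ → ℝ) (hκ : ∀ j, κ j = TropLaurent.cond p (B (k j))) :
    (∀ j, j ∈ T → j + 1 ∈ T → IsUnit (B (k j)).det →
      α j / α (j + 1) ≤ (1 + 2 * κ j) ^ (-2 : ℤ) →
        TropLaurent.HasEigenvaluesMinusPoles (TropLaurent.laurentSum B)
          {z : ℂ | ‖z‖ ≤ (1 + 2 * κ j) * α j} (n * k j) ∧
        ∀ z : ℂ, (1 + 2 * κ j) * α j < ‖z‖ → ‖z‖ < (1 + 2 * κ j)⁻¹ * α (j + 1) →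
          ¬ TropLaurent.IsEigenvalue (TropLaurent.laurentSum B) z) ∧
    (∀ j s, j < s → j ∈ T → j + 1 ∈ T → s ∈ T → s + 1 ∈ T →
      IsUnit (B (k j)).det → IsUnit (B (k s)).det →
      α j / α (j + 1) ≤ (1 + 2 * κ j) ^ (-2 : ℤ) →
      α s / α (s + 1) ≤ (1 + 2 * κ s) ^ (-2 : ℤ) →
        TropLaurent.HasEigenvalues (TropLaurent.laurentSum B)
          {z : ℂ | (1 + 2 * κ j)⁻¹ * α (j + 1) ≤ ‖z‖ ∧ ‖z‖ ≤ (1 + 2 * κ s) * α s}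
          (n * (k s - k j))) := by
  have hb0 : ∀ i, 0 ≤ b i := fun i => hb i ▸ TropLaurent.subNorm_nonneg (B i)
  have hbℓ : ∀ i < ℓ, b i = 0 := fun i hi => by rw [hb, hℓ i hi, TropLaurent.subNorm_zero]
  have hdom : ∀ j, j ∈ T → j + 1 ∈ T → IsUnit (B (k j)).det →
      TropLaurent.IsDominantIndex p B ℓ (α j) (α (j + 1)) (k j) := by
    intro j hj hj1 hu
    obtain ⟨h1, h2, h3, h4, h5⟩ := hα.dominant hb0 hbℓ hj hj1 (hk j hj)
    simp only [hb] at h3 h4 h5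
    exact ⟨hp, hℓ, h1, h2, h3, hu, h4, h5⟩
  -- The bound on `δ_j` is equivalent to the annulus of admissible radii being nonempty.
  have hgap : ∀ j, TropLaurent.IsDominantIndex p B ℓ (α j) (α (j + 1)) (k j) →
      α j / α (j + 1) ≤ (1 + 2 * κ j) ^ (-2 : ℤ) →
      (1 + 2 * TropLaurent.cond p (B (k j))) * α j ≤
        (1 + 2 * TropLaurent.cond p (B (k j)))⁻¹ * α (j + 1) := by
    intro j h hδ
    have hc := h.pos_right
    have hκj := h.cond_pos
    rw [← hκ] at hκj ⊢
    rw [div_le_iff₀ hc] at hδ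
    calc (1 + 2 * κ j) * α j ≤ (1 + 2 * κ j) * ((1 + 2 * κ j) ^ (-2 : ℤ) * α (j + 1)) := by gcongr
      _ = (1 + 2 * κ j)⁻¹ * α (j + 1) := by
        rw [zpow_neg]
        field_simp
  refine ⟨fun j hj hj1 hu hδ => ?_, fun j s hjs hj hj1 hs hs1 hu hu' hδ hδ' => ?_⟩
  · have h := hdom j hj hj1 hu
    rw [hκ]
    exact ⟨h.hasEigenvaluesMinusPoles (hgap j h hδ), fun z h1 h2 => h.not_isEigenvalue h1.le h2.le⟩
  · have h := hdom j hj hj1 hu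
    have h' := hdom s hs hs1 hu'
    rw [hκ, hκ]
    exact h.hasEigenvalues h' (hα.strictMono.monotoneOn hj1 hs (by omega)) (hgap j h hδ)
      (hgap s h' hδ')
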